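/- Let $G$ be a compact connected simple Lie group with Lie algebra $\mathfrak g$, and let $\theta_1,\theta_2$ be commuting involutions of $G$ (smooth automorphisms with $\theta_i^2=1$ and $\theta_1\theta_2=\theta_2\theta_1$). Denote their differentials on $\mathfrak g$, and the $\mathbb C$-linear extensions of these to $\mathfrak g^{\mathbb C}$, by the same symbols, and let $\mathfrak k_i$ and $\mathfrak m_i$ be the $(+1)$- and $(-1)$-eigenspaces of $\theta_i$ in $\mathfrak g$. Let $\langle\cdot,\cdot\rangle$ be an invariant inner product on $\mathfrak g$. Let $\mathfrak t$ be a maximal abelian subalgebra of $\mathfrak g$ such that $\mathfrak t\cap\mathfrak m_i$ is maximal abelian in $\mathfrak m_i$ for $i=1,2$ and $\mathfrak a:=\mathfrak t\cap\mathfrak m_1\cap\mathfrak m_2$ is maximal abelian in $\mathfrak m_1\cap\mathfrak m_2$. Let $\mathrm{pr}$ be the orthogonal projection onto $\mathfrak a$, and put $\sigma_i=-\theta_i|_{\mathfrak t}$. For $\mathfrak s\in\{\mathfrak t,\mathfrak a\}$ and $\alpha\in\mathfrak s$ put $\mathfrak g(\mathfrak s,\alpha)=\{X\in\mathfrak g^{\mathbb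 C}\mid [H,X]=\sqrt{-1}\,\langle\alpha,H\rangle X\ \text{for all } H\in\mathfrak s\}$, and let $$\Delta=\{\alpha\in\mathfrak t\setminus\{0\}\mid \mathfrak g(\mathfrak t,\alpha)\ne 0\},\qquad \tilde\Sigma=\{\lambda\in\mathfrak a\setminus\{0\}\mid \mathfrak g(\mathfrak a,\lambda)\neq 0\}.$$ For $\lambda\in\mathfrak a$ and $\epsilon=\pm1$ let $\mathfrak g(\mathfrak a,\lambda,\epsilon)=\{X\in\mathfrak g(\mathfrak a,\lambda)\mid\theta_1\theta_2X=\epsilon X\}$. Put $$\Sigma=\{\lambda\in\tilde\Sigma\mid\mathfrak g(\mathfrak a,\lambda,1)\ne0\},\quad W=\{\lambda\in\tilde\Sigma\mid\mathfrak g(\mathfrak a,\lambda,-1)\ne0\},$$ $$m(\lambda)=\dim_{\mathbb C}\mathfrak g(\mathfrak a,\lambda,1),\quad n(\lambda)=\dim_{\mathbb C}\mathfrak g(\mathfrak a,\lambda,-1).$$ Let $\Delta_0=\{\alpha\in\Delta\mid\langle\alpha,\mathfrak a\rangle=\{0\}\}$. A root $\alpha\in\Delta\setminus\Delta_0$ is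 called complex if $\sigma_1\sigma_2(\alpha)\neq\alpha$, compact if $\mathfrak g(\mathfrak t,\alpha)\subset((\mathfrak k_1\cap\mathfrak k_2)\oplus(\mathfrak m_1\cap\mathfrak m_2))^{\mathbb C}$, and noncompact if $\mathfrak g(\mathfrak t,\alpha)\subset((\mathfrak k_1\cap\mathfrak m_2)\oplus(\mathfrak m_1\cap\mathfrak k_2))^{\mathbb C}$. Let $\Delta_{\mathrm{cpx}},\Delta_{\mathrm{cpt}},\Delta_{\mathrm{noncpt}}\subset\Delta\setminus\Delta_0$ be the sets of complex, compact and noncompact roots. Then $$\Sigma=\mathrm{pr}(\Delta_{\mathrm{cpt}})\cup\mathrm{pr}(\Delta_{\mathrm{cpx}}),\qquad W=\mathrm{pr}(\Delta_{\mathrm{noncpt}})\cup\mathrm{pr}(\Delta_{\mathrm{cpx}}),$$ and for every $\lambda\in\tilde\Sigma$ $$m(\lambda)=\#\{\alpha\in\Delta_{\mathrm{cpt}}\mid\mathrm{pr}(\alpha)=\lambda\}+\tfrac12\#\{\beta\in\Delta_{\mathrm{cpx}}\mid\mathrm{pr}(\beta)=\lambda\},$$ $$n(\lambda)=\#\{\alpha\in\Delta_{\mathrm{noncpt}}\mid\mathrm{pr}(\alpha)=\lambda\}+\tfrac12\#\{\beta\in\Delta_{\mathrm{cpx}}\mid\mathrm{pr}(\beta)=\lambda\}.$$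 -/

import Mathlib

open scoped TensorProduct Manifold ContDiff

namespace SymmTriad

noncomputable section

/-! ### The Lie algebra of a Lie group and the differential of an automorphism -/

section Group

variable {E : Type*} [NormedAddCommGroup E] [NormedSpace ℝ E]
  {G : Type*} [TopologicalSpace G] [ChartedSpace E G] [Group G]

/-- A smooth real Lie group has the smoothness for which Mathlib defines its Lie algebra. -/
instance instLieGroupMinSmoothness [LieGroup 𝓘(ℝ, E) ∞ G] :
    LieGroup 𝓘(ℝ, E) (minSmoothness ℝ 3) G :=
  LieGroup.of_le (n := ∞) (by
    simp only [minSmoothness_of_isRCLikeNormedField]; exact ENat.LEInfty.out)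

instance instFiniteDimensionalGroupLieAlgebra [FiniteDimensional ℝ E]
    [LieGroup 𝓘(ℝ, E) ∞ G] :
    FiniteDimensional ℝ (GroupLieAlgebra 𝓘(ℝ, E) G) :=
  inferInstanceAs (FiniteDimensional ℝ E)

variable (E) in
/-- An involution of the Lie group `G`: a smooth group automorphism `θ` with `θ² = 1`. -/
structure IsInvolution (θ : G ≃* G) : Prop where
  contMDiff : ContMDiff 𝓘(ℝ, E) 𝓘(ℝ, E) ∞ θ
  apply_apply : ∀ g, θ (θ g) = g

variable (E) in
/-- The differential of the automorphism `θ` at the identity element, as an endomorphism of the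
Lie algebra of `G`; note that `θ 1 = 1`. -/
def differential [LieGroup 𝓘(ℝ, E) ∞ G] (θ : G ≃* G) :
    GroupLieAlgebra 𝓘(ℝ, E) G →ₗ[ℝ] GroupLieAlgebra 𝓘(ℝ, E) G :=
  (mfderiv 𝓘(ℝ, E) 𝓘(ℝ, E) θ (1 : G)).toLinearMap

end Group

/-! ### Invariant inner products, maximal abelian subspaces, root spaces -/

section LieAlg

variable {L : Type*} [LieRing L] [LieAlgebra ℝ L]

variable (L) in
/-- An invariant inner product on the real Lie algebra `L`: a positive definite symmetric bilinear
form for which every `ad X` is skew-symmetric. On the Lie algebra of a connected Lie group `G` the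
last condition is equivalent to invariance under `Ad(G)`. -/
structure InvariantInnerProduct where
  form : LinearMap.BilinForm ℝ L
  symm : ∀ x y : L, form x y = form y x
  pos : ∀ x : L, x ≠ 0 → 0 < form x x
  invariant : ∀ x y z : L, form ⁅x, y⁆ z = - form y ⁅x, z⁆

theorem InvariantInnerProduct.isCompl [FiniteDimensional ℝ L] (B : InvariantInnerProduct L)
    (s : Submodule ℝ L) : IsCompl s (B.form.orthogonal s) := by
  have hr : B.form.IsRefl := fun x y h => by rw [B.symm]; exact h
  rw [LinearMap.BilinForm.isCompl_orthogonal_iff_disjoint hr, Submodule.disjoint_def]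
  intro x hx hx'
  by_contra h0
  exact (B.pos x h0).ne' (LinearMap.BilinForm.mem_orthogonal_iff.mp hx' x hx)

/-- The orthogonal projection of `L` onto `s`. -/
def InvariantInnerProduct.proj [FiniteDimensional ℝ L] (B : InvariantInnerProduct L)
    (s : Submodule ℝ L) : L →ₗ[ℝ] L :=
  s.projection (B.form.orthogonal s) (B.isCompl s)

/-- `𝔨`, the `(+1)`-eigenspace of `θ`. -/
def kSpace (θ : Module.End ℝ L) : Submodule ℝ L := θ.eigenspace 1

/-- `𝔪`, the `(-1)`-eigenspace of `θ`. -/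
def mSpace (θ : Module.End ℝ L) : Submodule ℝ L := θ.eigenspace (-1)

/-- `s` is a maximal abelian subspace of `V`. -/
def IsMaximalAbelian (V s : Submodule ℝ L) : Prop :=
  Maximal (fun u : Submodule ℝ L => u ≤ V ∧ ∀ x ∈ u, ∀ y ∈ u, ⁅x, y⁆ = 0) s

/-- `t` is a maximal abelian subalgebra of `L` adapted to `θ₁` and `θ₂`. -/
structure IsAdaptedTorus (θ₁ θ₂ : Module.End ℝ L) (t : Submodule ℝ L) : Prop where
  maximal : IsMaximalAbelian ⊤ t
  maximal_left : IsMaximalAbelian (mSpace θ₁) (t ⊓ mSpace θ₁)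
  maximal_right : IsMaximalAbelian (mSpace θ₂) (t ⊓ mSpace θ₂)
  maximal_inf : IsMaximalAbelian (mSpace θ₁ ⊓ mSpace θ₂) (t ⊓ (mSpace θ₁ ⊓ mSpace θ₂))

/-- The abelian subspace `𝔞 = 𝔱 ∩ (𝔪₁ ∩ 𝔪₂)`. -/
def aSpace (θ₁ θ₂ : Module.End ℝ L) (t : Submodule ℝ L) : Submodule ℝ L :=
  t ⊓ (mSpace θ₁ ⊓ mSpace θ₂)

/-- `𝔤(s, α) = {X ∈ 𝔤^ℂ | [H, X] = √-1 ⟨α, H⟩ X for all H ∈ s}`. -/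
def rootSpace (B : InvariantInnerProduct L) (s : Submodule ℝ L) (α : L) :
    Submodule ℂ (ℂ ⊗[ℝ] L) :=
  ⨅ H ∈ s, Module.End.eigenspace (LieAlgebra.ad ℂ (ℂ ⊗[ℝ] L) ((1 : ℂ) ⊗ₜ[ℝ] H))
    (Complex.I * (B.form α H : ℂ))

/-- The nonzero `α ∈ s` with `𝔤(s, α) ≠ 0`. For `s = 𝔱` this is the root system `Δ` of `𝔤`, for
`s = 𝔞` it is the set `Σ̃`. -/
def roots (B : InvariantInnerProduct L) (s : Submodule ℝ L) : Set L :=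
  {α | α ∈ s ∧ α ≠ 0 ∧ rootSpace B s α ≠ ⊥}

/-- `𝔤(𝔞, α, ε) = {X ∈ 𝔤(𝔞, α) | θ₁ θ₂ X = ε X}`. -/
def signedRootSpace (B : InvariantInnerProduct L) (θ₁ θ₂ : Module.End ℝ L)
    (a : Submodule ℝ L) (α : L) (ε : ℂ) : Submodule ℂ (ℂ ⊗[ℝ] L) :=
  rootSpace B a α ⊓ Module.End.eigenspace ((θ₁ * θ₂).baseChange ℂ) ε

/-- `Σ`. -/
def sigmaSet (B : InvariantInnerProduct L) (θ₁ θ₂ : Module.End ℝ L) (a : Submodule ℝ L) :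
    Set L :=
  {α | α ∈ roots B a ∧ signedRootSpace B θ₁ θ₂ a α 1 ≠ ⊥}

/-- `W`. -/
def wSet (B : InvariantInnerProduct L) (θ₁ θ₂ : Module.End ℝ L) (a : Submodule ℝ L) :
    Set L :=
  {α | α ∈ roots B a ∧ signedRootSpace B θ₁ θ₂ a α (-1) ≠ ⊥}

/-- The multiplicity `m(α)`. -/
def mMult (B : InvariantInnerProduct L) (θ₁ θ₂ : Module.End ℝ L) (a : Submodule ℝ L)
    (α : L) : ℕ :=
  Module.finrank ℂ (signedRootSpace B θ₁ θ₂ a α 1)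

/-- The multiplicity `n(α)`. -/
def nMult (B : InvariantInnerProduct L) (θ₁ θ₂ : Module.End ℝ L) (a : Submodule ℝ L)
    (α : L) : ℕ :=
  Module.finrank ℂ (signedRootSpace B θ₁ θ₂ a α (-1))

/-! ### Complex, compact and noncompact roots -/

/-- `Δ₀`, the roots orthogonal to `𝔞`. -/
def rootsZero (B : InvariantInnerProduct L) (θ₁ θ₂ : Module.End ℝ L) (t : Submodule ℝ L) :
    Set L :=
  {α | α ∈ roots B t ∧ ∀ H ∈ aSpace θ₁ θ₂ t, B.form α H = 0}

/-- `σ = -θ`, to be evaluated on the `θ`-invariant subspace `𝔱`. -/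
def sigmaMap (θ : Module.End ℝ L) : Module.End ℝ L := -θ

/-- The complex roots. -/
def rootsCpx (B : InvariantInnerProduct L) (θ₁ θ₂ : Module.End ℝ L) (t : Submodule ℝ L) :
    Set L :=
  {α | α ∈ roots B t \ rootsZero B θ₁ θ₂ t ∧ sigmaMap θ₁ (sigmaMap θ₂ α) ≠ α}

/-- The compact roots: `𝔤(𝔱, α) ⊆ ((𝔨₁ ∩ 𝔨₂) ⊕ (𝔪₁ ∩ 𝔪₂))^ℂ`. -/
def rootsCpt (B : InvariantInnerProduct L) (θ₁ θ₂ : Module.End ℝ L) (t : Submodule ℝ L) :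
    Set L :=
  {α | α ∈ roots B t \ rootsZero B θ₁ θ₂ t ∧
    rootSpace B t α ≤
      ((kSpace θ₁ ⊓ kSpace θ₂) ⊔ (mSpace θ₁ ⊓ mSpace θ₂)).baseChange ℂ}

/-- The noncompact roots: `𝔤(𝔱, α) ⊆ ((𝔨₁ ∩ 𝔪₂) ⊕ (𝔪₁ ∩ 𝔨₂))^ℂ`. -/
def rootsNoncpt (B : InvariantInnerProduct L) (θ₁ θ₂ : Module.End ℝ L) (t : Submodule ℝ L) :
    Set L :=
  {α | α ∈ roots B t \ rootsZero B θ₁ θ₂ t ∧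
    rootSpace B t α ≤
      ((kSpace θ₁ ⊓ mSpace θ₂) ⊔ (mSpace θ₁ ⊓ kSpace θ₂)).baseChange ℂ}

end LieAlg

end

end SymmTriad

/-!
The automorphism `σ = θ₁ θ₂` of `𝔤` preserves `𝔱` and fixes `𝔞` pointwise, because each `θᵢ` acts on
`𝔞` by `-1`. It is an isometry: invariant symmetric forms on a simple Lie algebra are proportional,
so the pullback of the inner product along `σ` is a multiple of it, and as `σ² = 1` the factor is a
positive square root of `1`.

For `λ ≠ 0` the space `𝔤(𝔞, λ)` is the direct sum of the root spaces `𝔤(𝔱, α)` with `pr α = λ`. Each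
of these is a line: with respect to the Hermitian extension of the inner product, if `E` and `X` in
`𝔤(𝔱, α)` are orthogonal, then `[Ē, X] = 0` and `[Ē, E] = -√-1 ‖E‖² α`, hence
`‖[E, X]‖² = -‖E‖² ‖α‖² ‖X‖²` and one of `E` and `X` vanishes.

Since `σ` maps `𝔤(𝔱, α)` to `𝔤(𝔱, σ α)`, it permutes the lines over `λ`, and the dimension of its
`ε`-eigenspace in `𝔤(𝔞, λ)` is the trace of the projection `(1 + ε σ) / 2`. A root moved by `σ`,
that is, a complex root, contributes `1 / 2` to this trace. A root fixed by `σ` contributes `1` or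
`0` according to whether `σ` acts on its line by `ε` or by `-ε`. For `ε = 1` and `ε = -1` the former
means that the root is compact and noncompact, respectively, because `((𝔨₁ ∩ 𝔨₂) ⊕ (𝔪₁ ∩ 𝔪₂))^ℂ` and
`((𝔨₁ ∩ 𝔪₂) ⊕ (𝔪₁ ∩ 𝔨₂))^ℂ` are the eigenspaces of `σ`.
-/

namespace SymmTriad

noncomputable section

section Group

open VectorField

variable {E : Type*} [NormedAddCommGroup E] [NormedSpace ℝ E]
  {G : Type*} [TopologicalSpace G] [ChartedSpace E G] [Group G] [LieGroup 𝓘(ℝ, E) ∞ G]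

theorem differential_refl : differential E (MulEquiv.refl G) = 1 :=
  LinearMap.ext fun v => DFunLike.congr_fun (mfderiv_id (I := 𝓘(ℝ, E)) (x := (1 : G))) v

theorem differential_trans {Φ Ψ : G ≃* G} (hΦ : ContMDiff 𝓘(ℝ, E) 𝓘(ℝ, E) ∞ Φ)
    (hΨ : ContMDiff 𝓘(ℝ, E) 𝓘(ℝ, E) ∞ Ψ) :
    differential E (Ψ.trans Φ) = differential E Φ * differential E Ψ := by
  refine LinearMap.ext fun v => ?_
  have chain_rule := DFunLike.congr_fun (mfderiv_comp (1 : G)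
    (hΦ.contMDiffAt.mdifferentiableAt (x := Ψ 1) (by simp))
    (hΨ.contMDiffAt.mdifferentiableAt (by simp))) v
  have base_point : (mfderiv 𝓘(ℝ, E) 𝓘(ℝ, E) Φ (Ψ 1) : E → E) =
      mfderiv 𝓘(ℝ, E) 𝓘(ℝ, E) Φ (1 : G) := by
    rw [map_one]
  exact chain_rule.trans (congrFun base_point _)

theorem mfderiv_mulInvariantVectorField {Θ : G ≃* G} (hΘ : ContMDiff 𝓘(ℝ, E) 𝓘(ℝ, E) ∞ Θ)
    (v : GroupLieAlgebra 𝓘(ℝ, E) G) (g : G) :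
    mfderiv 𝓘(ℝ, E) 𝓘(ℝ, E) Θ g (mulInvariantVectorField v g) =
      mulInvariantVectorField (differential E Θ v) (Θ g) := by
  have hΘd (x : G) : MDifferentiableAt 𝓘(ℝ, E) 𝓘(ℝ, E) Θ x :=
    hΘ.contMDiffAt.mdifferentiableAt (by simp)
  have hmul (x y : G) : MDifferentiableAt 𝓘(ℝ, E) 𝓘(ℝ, E) (x * ·) y :=
    (contMDiff_mul_left (I := 𝓘(ℝ, E)) (n := ∞)).contMDiffAt.mdifferentiableAt (by simp)
  have chain_rules := mfderiv_comp (1 : G) (hmul (Θ g) (Θ 1)) (hΘd 1)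
  rw [show (Θ g * ·) ∘ Θ = Θ ∘ (g * ·) by ext; simp,
    mfderiv_comp (1 : G) (hΘd (g * 1)) (hmul g 1)] at chain_rules
  have base_point_left : (mfderiv 𝓘(ℝ, E) 𝓘(ℝ, E) Θ (g * 1) : E → E) =
      mfderiv 𝓘(ℝ, E) 𝓘(ℝ, E) Θ g := by
    rw [mul_one]
  have base_point_right : (mfderiv 𝓘(ℝ, E) 𝓘(ℝ, E) (Θ g * ·) (Θ 1) : E → E) =
      mfderiv 𝓘(ℝ, E) 𝓘(ℝ, E) (Θ g * ·) (1 : G) := by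
    rw [map_one]
  exact (congrFun base_point_left _).symm.trans
    ((DFunLike.congr_fun chain_rules v).trans (congrFun base_point_right _))

omit [LieGroup 𝓘(ℝ, E) ∞ G] in
theorem isInvertible_mfderiv {Θ : G ≃* G} (hΘ : ContMDiff 𝓘(ℝ, E) 𝓘(ℝ, E) ∞ Θ)
    (hΘ' : ContMDiff 𝓘(ℝ, E) 𝓘(ℝ, E) ∞ Θ.symm) (g : G) :
    (mfderiv 𝓘(ℝ, E) 𝓘(ℝ, E) Θ g).IsInvertible :=
  ⟨Diffeomorph.mfderivToContinuousLinearEquiv ⟨Θ.toEquiv, hΘ, hΘ'⟩ (by simp) g, rfl⟩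

theorem mpullback_mulInvariantVectorField_differential {Θ : G ≃* G}
    (hΘ : ContMDiff 𝓘(ℝ, E) 𝓘(ℝ, E) ∞ Θ) (hΘ' : ContMDiff 𝓘(ℝ, E) 𝓘(ℝ, E) ∞ Θ.symm)
    (v : GroupLieAlgebra 𝓘(ℝ, E) G) :
    mpullback 𝓘(ℝ, E) 𝓘(ℝ, E) Θ (mulInvariantVectorField (differential E Θ v)) =
      mulInvariantVectorField v := by
  funext g
  rw [mpullback_apply, (isInvertible_mfderiv hΘ hΘ' g).inverse_apply_eq]
  exact (mfderiv_mulInvariantVectorField hΘ v g).symm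

theorem differential_lie [CompleteSpace E] {Θ : G ≃* G} (hΘ : ContMDiff 𝓘(ℝ, E) 𝓘(ℝ, E) ∞ Θ)
    (hΘ' : ContMDiff 𝓘(ℝ, E) 𝓘(ℝ, E) ∞ Θ.symm) (v w : GroupLieAlgebra 𝓘(ℝ, E) G) :
    differential E Θ ⁅v, w⁆ = ⁅differential E Θ v, differential E Θ w⁆ := by
  have pullback_bracket := mpullback_mlieBracket (x₀ := (1 : G))
    (mdifferentiableAt_mulInvariantVectorField (differential E Θ v) (g := Θ 1))
    (mdifferentiableAt_mulInvariantVectorField (differential E Θ w)) hΘ.contMDiffAt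
    (by simp only [minSmoothness_of_isRCLikeNormedField]; exact ENat.LEInfty.out)
  rw [mpullback_mulInvariantVectorField_differential hΘ hΘ',
    mpullback_mulInvariantVectorField_differential hΘ hΘ', mpullback_apply,
    (isInvertible_mfderiv hΘ hΘ' 1).inverse_apply_eq] at pullback_bracket
  rw [GroupLieAlgebra.bracket_def, GroupLieAlgebra.bracket_def]
  conv_rhs => rw [← map_one Θ]
  exact pullback_bracket.symm

end Group

section Complexification

variable {L : Type*} [LieRing L] [LieAlgebra ℝ L]

variable (L) in
/-- The bracket of the Lie ring `ℂ ⊗ L`. It is the one `LieAlgebra.ad` uses, whereas instance search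
would find the bracket of the base change of a Lie module. -/
@[reducible]
def complexBracket : Bracket (ℂ ⊗[ℝ] L) (ℂ ⊗[ℝ] L) :=
  (lieRingSelfModule : LieRingModule (ℂ ⊗[ℝ] L) (ℂ ⊗[ℝ] L)).toBracket

attribute [local instance] complexBracket

theorem tmul_ofReal_smul (c : ℝ) (x : L) :
    (1 : ℂ) ⊗ₜ[ℝ] (c • x) = (c : ℂ) • ((1 : ℂ) ⊗ₜ[ℝ] x) := by
  rw [← TensorProduct.smul_tmul, TensorProduct.smul_tmul', Complex.real_smul, smul_eq_mul]

theorem exists_eq_tmul_add_I_smul_tmul (X : ℂ ⊗[ℝ] L) :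
    ∃ x y : L, X = (1 : ℂ) ⊗ₜ[ℝ] x + Complex.I • ((1 : ℂ) ⊗ₜ[ℝ] y) := by
  induction X using TensorProduct.induction_on with
  | zero => exact ⟨0, 0, by simp⟩
  | tmul c x =>
    refine ⟨c.re • x, c.im • x, ?_⟩
    rw [tmul_ofReal_smul, tmul_ofReal_smul, smul_smul, ← add_smul, mul_comm, Complex.re_add_im,
      TensorProduct.smul_tmul', smul_eq_mul, mul_one]
  | add X Y hX hY =>
    obtain ⟨x, y, rfl⟩ := hX
    obtain ⟨x', y', rfl⟩ := hY
    exact ⟨x + x', y + y', by simp only [TensorProduct.tmul_add, smul_add]; abel⟩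

variable (L) in
/-- Complex conjugation on `𝔤^ℂ = ℂ ⊗ 𝔤` with respect to the real form `𝔤`. -/
def conj : ℂ ⊗[ℝ] L →ₗ⋆[ℂ] ℂ ⊗[ℝ] L where
  __ := (Complex.conjAe.toLinearMap.rTensor L).toAddHom
  map_smul' c X := by
    induction X using TensorProduct.induction_on with
    | zero => simp
    | tmul d x => simp [TensorProduct.smul_tmul']
    | add X Y hX hY => simp_all

@[simp]
theorem conj_tmul (c : ℂ) (x : L) : conj L (c ⊗ₜ[ℝ] x) = starRingEnd ℂ c ⊗ₜ[ℝ] x :=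
  rfl

theorem conj_lie (X Y : ℂ ⊗[ℝ] L) : conj L ⁅X, Y⁆ = ⁅conj L X, conj L Y⁆ :=
  (LieAlgebra.ExtendScalars.map (Complex.conjAe : ℂ →ₐ[ℝ] ℂ) (LieHom.id : L →ₗ⁅ℝ⁆ L)).map_lie X Y

theorem complex_smul_lie (c : ℂ) (X Y : ℂ ⊗[ℝ] L) : ⁅c • X, Y⁆ = c • ⁅X, Y⁆ :=
  DFunLike.congr_fun (map_smul (LieAlgebra.ad ℂ (ℂ ⊗[ℝ] L)) c X) Y

theorem tmul_add_I_smul_tmul_inj {x y x' y' : L} :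
    (1 : ℂ) ⊗ₜ[ℝ] x + Complex.I • ((1 : ℂ) ⊗ₜ[ℝ] y) =
      (1 : ℂ) ⊗ₜ[ℝ] x' + Complex.I • ((1 : ℂ) ⊗ₜ[ℝ] y') ↔ x = x' ∧ y = y' := by
  refine ⟨fun h => ⟨?_, ?_⟩, fun ⟨hx, hy⟩ => by rw [hx, hy]⟩
  · simpa [TensorProduct.smul_tmul'] using
      congrArg (TensorProduct.lid ℝ L ∘ Complex.reLm.rTensor L) h
  · simpa [TensorProduct.smul_tmul'] using
      congrArg (TensorProduct.lid ℝ L ∘ Complex.imLm.rTensor L) h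

end Complexification

section HermitianForm

open scoped ComplexOrder

attribute [local instance] complexBracket

namespace InvariantInnerProduct

variable {L : Type*} [LieRing L] [LieAlgebra ℝ L] (B : InvariantInnerProduct L)

theorem form_self_nonneg (x : L) : 0 ≤ B.form x x := by
  rcases eq_or_ne x 0 with rfl | hx
  · simp
  · exact (B.pos x hx).le

theorem eq_zero_of_form_self_eq_zero {x : L} (h : B.form x x = 0) : x = 0 :=
  not_imp_comm.mp (B.pos x) h.not_gt

theorem eq_of_forall_form_eq {s : Submodule ℝ L} {α β : L} (hα : α ∈ s) (hβ : β ∈ s)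
    (h : ∀ H ∈ s, B.form α H = B.form β H) : α = β := by
  refine sub_eq_zero.mp (B.eq_zero_of_form_self_eq_zero ?_)
  rw [LinearMap.map_sub₂, h _ (s.sub_mem hα hβ), sub_self]

/-- The Hermitian form on `𝔤^ℂ` extending an invariant inner product on `𝔤`; it is conjugate linear
in the first variable. -/
def herm : ℂ ⊗[ℝ] L →ₗ⋆[ℂ] ℂ ⊗[ℝ] L →ₗ[ℂ] ℂ :=
  LinearMap.comp (B.form.baseChange ℂ) (conj L)

@[simp]
theorem herm_tmul (c d : ℂ) (x y : L) :
    B.herm (c ⊗ₜ[ℝ] x) (d ⊗ₜ[ℝ] y) = (B.form x y : ℂ) * (starRingEnd ℂ c * d) := by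
  rw [herm, LinearMap.comp_apply, conj_tmul, LinearMap.BilinForm.baseChange_tmul,
    Complex.real_smul]

theorem conj_herm (X Y : ℂ ⊗[ℝ] L) : starRingEnd ℂ (B.herm X Y) = B.herm Y X := by
  obtain ⟨x, x', rfl⟩ := exists_eq_tmul_add_I_smul_tmul X
  obtain ⟨y, y', rfl⟩ := exists_eq_tmul_add_I_smul_tmul Y
  simp only [map_add, LinearMap.map_smulₛₗ, Complex.conj_I, neg_smul, LinearMap.add_apply,
    herm_tmul, map_one, mul_one, map_smul, smul_eq_mul, LinearMap.neg_apply, LinearMap.smul_apply,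
    Complex.conj_ofReal, map_mul, neg_mul, map_neg, neg_neg, B.symm y, B.symm y']
  ring

theorem herm_lie (X Y Z : ℂ ⊗[ℝ] L) : B.herm ⁅X, Y⁆ Z = -B.herm Y ⁅conj L X, Z⁆ := by
  obtain ⟨x, x', rfl⟩ := exists_eq_tmul_add_I_smul_tmul X
  obtain ⟨y, y', rfl⟩ := exists_eq_tmul_add_I_smul_tmul Y
  obtain ⟨z, z', rfl⟩ := exists_eq_tmul_add_I_smul_tmul Z
  simp only [lie_add, add_lie, LieAlgebra.ExtendScalars.bracket_tmul, mul_one, complex_smul_lie,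
    lie_smul, smul_add, map_add, LinearMap.map_smulₛₗ, Complex.conj_I, neg_smul, smul_neg, neg_neg,
    LinearMap.add_apply, herm_tmul, B.invariant, Complex.ofReal_neg, map_one, map_smul,
    smul_eq_mul, mul_neg, LinearMap.neg_apply, LinearMap.smul_apply, conj_tmul, neg_lie, smul_lie,
    map_neg, neg_add_rev]
  ring

theorem herm_self_pos {X : ℂ ⊗[ℝ] L} (hX : X ≠ 0) : 0 < B.herm X X := by
  obtain ⟨x, y, rfl⟩ := exists_eq_tmul_add_I_smul_tmul X
  have herm_eq : B.herm ((1 : ℂ) ⊗ₜ[ℝ] x + Complex.I • ((1 : ℂ) ⊗ₜ[ℝ] y))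
      ((1 : ℂ) ⊗ₜ[ℝ] x + Complex.I • ((1 : ℂ) ⊗ₜ[ℝ] y)) = (B.form x x + B.form y y : ℝ) := by
    simp only [map_add, LinearMap.map_smulₛₗ, Complex.conj_I, neg_smul, LinearMap.add_apply,
      herm_tmul, map_one, mul_one, map_smul, smul_eq_mul, LinearMap.neg_apply,
      LinearMap.smul_apply, B.symm y x, Complex.ofReal_add]
    linear_combination -(B.form y y : ℂ) * Complex.I_sq
  rw [herm_eq, Complex.zero_lt_real]
  rcases eq_or_ne x 0 with rfl | hx
  · have hy : y ≠ 0 := by rintro rfl; simp at hX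
    exact add_pos_of_nonneg_of_pos (B.form_self_nonneg 0) (B.pos y hy)
  · exact add_pos_of_pos_of_nonneg (B.pos x hx) (B.form_self_nonneg y)

theorem herm_self_nonneg (X : ℂ ⊗[ℝ] L) : 0 ≤ B.herm X X := by
  rcases eq_or_ne X 0 with rfl | hX
  · simp
  · exact (B.herm_self_pos hX).le

theorem eq_zero_of_herm_self_eq_zero {X : ℂ ⊗[ℝ] L} (h : B.herm X X = 0) : X = 0 :=
  not_imp_comm.mp B.herm_self_pos h.not_gt

/-- The Hermitian inner product on `𝔤^ℂ` given by `InvariantInnerProduct.herm`. -/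
@[reducible]
def hermCore : InnerProductSpace.Core ℂ (ℂ ⊗[ℝ] L) where
  inner X Y := B.herm X Y
  conj_inner_symm X Y := B.conj_herm Y X
  re_inner_nonneg X := (Complex.le_def.mp (B.herm_self_nonneg X)).1
  add_left X Y Z := by simp
  smul_left X Y c := by simp
  definite _ h := B.eq_zero_of_herm_self_eq_zero h

end InvariantInnerProduct

end HermitianForm

section RootSpaces

attribute [local instance] complexBracket

variable {L : Type*} [LieRing L] [LieAlgebra ℝ L] {B : InvariantInnerProduct L}
  {s t : Submodule ℝ L} {α β : L} {X Y : ℂ ⊗[ℝ] L}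

theorem mem_rootSpace : X ∈ rootSpace B s α ↔
    ∀ H ∈ s, ⁅(1 : ℂ) ⊗ₜ[ℝ] H, X⁆ = (Complex.I * (B.form α H : ℂ)) • X := by
  simp [rootSpace, Submodule.mem_iInf]

theorem mem_rootSpace_span {S : Set L} : X ∈ rootSpace B (Submodule.span ℝ S) α ↔
    ∀ H ∈ S, ⁅(1 : ℂ) ⊗ₜ[ℝ] H, X⁆ = (Complex.I * (B.form α H : ℂ)) • X := by
  rw [mem_rootSpace]
  refine ⟨fun h H hH => h H (Submodule.subset_span hH), fun h H hH => ?_⟩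
  induction hH using Submodule.span_induction with
  | mem H hH => exact h H hH
  | zero => simp
  | add H K _ _ hH hK => simp [TensorProduct.tmul_add, hH, hK, mul_add, add_smul]
  | smul c H _ hH =>
    rw [tmul_ofReal_smul, complex_smul_lie, hH, smul_smul, map_smul, smul_eq_mul,
      Complex.ofReal_mul, mul_left_comm]

theorem rootSpace_le_rootSpace (hst : s ≤ t) (h : ∀ H ∈ s, B.form α H = B.form β H) :
    rootSpace B t α ≤ rootSpace B s β := fun _ hX =>
  mem_rootSpace.mpr fun H hH => by rw [mem_rootSpace.mp hX H (hst hH), h H hH]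

theorem conj_mem_rootSpace (hX : X ∈ rootSpace B s α) : conj L X ∈ rootSpace B s (-α) :=
  mem_rootSpace.mpr fun H hH => by
    simpa [conj_lie] using congrArg (conj L) (mem_rootSpace.mp hX H hH)

theorem lie_mem_rootSpace (hX : X ∈ rootSpace B s α) (hY : Y ∈ rootSpace B s β) :
    ⁅X, Y⁆ ∈ rootSpace B s (α + β) :=
  mem_rootSpace.mpr fun H hH => by
    rw [leibniz_lie, mem_rootSpace.mp hX H hH, mem_rootSpace.mp hY H hH, complex_smul_lie,
      lie_smul, ← add_smul, map_add, LinearMap.add_apply, Complex.ofReal_add, mul_add]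

theorem herm_eq_zero_of_mem_rootSpace (hα : α ∈ s) (hβ : β ∈ s) (hne : α ≠ β)
    (hX : X ∈ rootSpace B s α) (hY : Y ∈ rootSpace B s β) : B.herm X Y = 0 := by
  by_contra h0
  refine hne (B.eq_of_forall_form_eq hα hβ fun H hH => ?_)
  have h := B.herm_lie ((1 : ℂ) ⊗ₜ[ℝ] H) X Y
  rw [conj_tmul, map_one, mem_rootSpace.mp hX H hH, mem_rootSpace.mp hY H hH,
    LinearMap.map_smulₛₗ₂, map_smul, smul_eq_mul, smul_eq_mul, ← neg_mul] at h
  simpa using mul_right_cancel₀ h0 h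

variable (B) in
theorem iSupIndep_rootSpace {S : Set L} (hS : S ⊆ s) :
    iSupIndep fun α : S => rootSpace B s (α : L) := by
  let := B.hermCore.toNormedAddCommGroup
  let : InnerProductSpace ℂ (ℂ ⊗[ℝ] L) := InnerProductSpace.ofCore B.hermCore.toCore
  refine OrthogonalFamily.independent (𝕜 := ℂ) fun α β hne X Y => ?_
  exact herm_eq_zero_of_mem_rootSpace (hS α.2) (hS β.2) (Subtype.coe_ne_coe.mpr hne) X.2 Y.2

end RootSpaces

section OneDimensional

open scoped ComplexOrder

attribute [local instance] complexBracket

variable {L : Type*} [LieRing L] [LieAlgebra ℝ L] {B : InvariantInnerProduct L}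
  {V s t : Submodule ℝ L} {α : L} {E X Z : ℂ ⊗[ℝ] L}

theorem IsMaximalAbelian.mem_of_forall_lie_eq_zero (hs : IsMaximalAbelian V s) {x : L}
    (hxV : x ∈ V) (hx : ∀ H ∈ s, ⁅H, x⁆ = 0) : x ∈ s := by
  have abelian : ∀ y ∈ s ⊔ Submodule.span ℝ {x}, ∀ z ∈ s ⊔ Submodule.span ℝ {x}, ⁅y, z⁆ = 0 := by
    intro y hy z hz
    obtain ⟨y, hys, _, hy', rfl⟩ := Submodule.mem_sup.mp hy
    obtain ⟨z, hzs, _, hz', rfl⟩ := Submodule.mem_sup.mp hz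
    obtain ⟨c, rfl⟩ := Submodule.mem_span_singleton.mp hy'
    obtain ⟨d, rfl⟩ := Submodule.mem_span_singleton.mp hz'
    have hxz : ⁅x, z⁆ = 0 := by rw [← lie_skew, hx z hzs, neg_zero]
    simp [hs.prop.2 y hys z hzs, hx y hys, hxz]
  exact hs.le_of_ge ⟨sup_le hs.prop.1 (by simpa using hxV), abelian⟩ le_sup_left
    (Submodule.mem_sup_right (Submodule.mem_span_singleton_self x))

theorem rootSpace_zero_le_baseChange (ht : IsMaximalAbelian ⊤ t) :
    rootSpace B t 0 ≤ t.baseChange ℂ := by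
  intro Z hZ
  obtain ⟨x, y, rfl⟩ := exists_eq_tmul_add_I_smul_tmul Z
  have lie_eq_zero : ∀ H ∈ t, ⁅H, x⁆ = 0 ∧ ⁅H, y⁆ = 0 := fun H hH =>
    tmul_add_I_smul_tmul_inj.mp (by simpa using mem_rootSpace.mp hZ H hH)
  have hx : x ∈ t := ht.mem_of_forall_lie_eq_zero trivial fun H hH => (lie_eq_zero H hH).1
  have hy : y ∈ t := ht.mem_of_forall_lie_eq_zero trivial fun H hH => (lie_eq_zero H hH).2
  exact add_mem (Submodule.tmul_mem_baseChange_of_mem 1 hx)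
    (Submodule.smul_mem _ _ (Submodule.tmul_mem_baseChange_of_mem 1 hy))

theorem eq_zero_of_mem_baseChange (hZ : Z ∈ s.baseChange ℂ)
    (h : ∀ H ∈ s, B.herm ((1 : ℂ) ⊗ₜ[ℝ] H) Z = 0) : Z = 0 := by
  have le_ker : s.baseChange ℂ ≤ LinearMap.ker (B.herm.flip Z) := by
    rw [Submodule.baseChange_eq_span, Submodule.span_le]
    rintro _ ⟨H, hH, rfl⟩
    exact h H hH
  exact B.eq_zero_of_herm_self_eq_zero (le_ker hZ)

theorem lie_conj_eq_smul (ht : IsMaximalAbelian ⊤ t) (hα : α ∈ t) (hE : E ∈ rootSpace B t α)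
    (hX : X ∈ rootSpace B t α) :
    ⁅conj L E, X⁆ = -(Complex.I * B.herm E X) • ((1 : ℂ) ⊗ₜ[ℝ] α) := by
  have lie_mem : ⁅conj L E, X⁆ ∈ t.baseChange ℂ := by
    have h := lie_mem_rootSpace (conj_mem_rootSpace hE) hX
    rw [neg_add_cancel] at h
    exact rootSpace_zero_le_baseChange ht h
  rw [← sub_eq_zero]
  refine eq_zero_of_mem_baseChange (B := B) (sub_mem lie_mem
    (Submodule.smul_mem _ _ (Submodule.tmul_mem_baseChange_of_mem 1 hα))) fun H hH => ?_
  have h := B.herm_lie E ((1 : ℂ) ⊗ₜ[ℝ] H) X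
  rw [← lie_skew, mem_rootSpace.mp hE H hH, map_neg, LinearMap.neg_apply, neg_inj,
    LinearMap.map_smulₛₗ₂] at h
  rw [map_sub, ← h, map_smul, B.herm_tmul, B.symm H]
  simp only [map_mul, Complex.conj_I, Complex.conj_ofReal, map_one, smul_eq_mul]
  ring

theorem eq_zero_of_herm_eq_zero (ht : IsMaximalAbelian ⊤ t) (hα : α ∈ t) (hα0 : α ≠ 0)
    (hE : E ∈ rootSpace B t α) (hE0 : E ≠ 0) (hX : X ∈ rootSpace B t α)
    (hEX : B.herm E X = 0) : X = 0 := by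
  have lie_lie_eq : ⁅conj L E, ⁅E, X⁆⁆ = (B.herm E E * (B.form α α : ℂ)) • X := by
    rw [leibniz_lie, lie_conj_eq_smul ht hα hE hX, hEX, lie_conj_eq_smul ht hα hE hE,
      complex_smul_lie, mem_rootSpace.mp hX α hα, smul_smul, mul_zero, neg_zero, zero_smul,
      lie_zero, add_zero]
    congr 1
    linear_combination -(B.herm E E * B.form α α) * Complex.I_sq
  have herm_lie_self : B.herm ⁅E, X⁆ ⁅E, X⁆ = -(B.herm E E * B.form α α * B.herm X X) := by
    rw [B.herm_lie, lie_lie_eq, map_smul, smul_eq_mul]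
  by_contra hX0
  have hpos : 0 < B.herm E E * B.form α α * B.herm X X :=
    mul_pos (mul_pos (B.herm_self_pos hE0) (Complex.zero_lt_real.mpr (B.pos α hα0)))
      (B.herm_self_pos hX0)
  exact (neg_neg_of_pos hpos).not_ge (herm_lie_self ▸ B.herm_self_nonneg _)

theorem rootSpace_eq_span_singleton (ht : IsMaximalAbelian ⊤ t) (hα : α ∈ t) (hα0 : α ≠ 0)
    (hE : E ∈ rootSpace B t α) (hE0 : E ≠ 0) : rootSpace B t α = Submodule.span ℂ {E} := by
  refine le_antisymm (fun X hX => ?_) (by simpa using hE)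
  have hEE : B.herm E E ≠ 0 := (B.herm_self_pos hE0).ne'
  refine Submodule.mem_span_singleton.mpr ⟨B.herm E X / B.herm E E, ?_⟩
  refine (sub_eq_zero.mp (eq_zero_of_herm_eq_zero ht hα hα0 hE hE0
    (sub_mem hX (Submodule.smul_mem _ _ hE)) ?_)).symm
  rw [map_sub, map_smul, smul_eq_mul, div_mul_cancel₀ _ hEE, sub_self]

end OneDimensional

section Spanning

attribute [local instance] complexBracket

variable {L : Type*} [LieRing L] [LieAlgebra ℝ L] (B : InvariantInnerProduct L)
  {s : Submodule ℝ L}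

omit B in
theorem commute_ad_tmul {H K : L} (h : ⁅H, K⁆ = 0) :
    Commute (LieAlgebra.ad ℂ (ℂ ⊗[ℝ] L) ((1 : ℂ) ⊗ₜ[ℝ] H))
      (LieAlgebra.ad ℂ (ℂ ⊗[ℝ] L) ((1 : ℂ) ⊗ₜ[ℝ] K)) := by
  refine LinearMap.ext fun X => ?_
  simp [leibniz_lie ((1 : ℂ) ⊗ₜ[ℝ] H), h]

theorem herm_I_smul_ad (H : L) (X Y : ℂ ⊗[ℝ] L) :
    B.herm ((Complex.I • LieAlgebra.ad ℂ (ℂ ⊗[ℝ] L) ((1 : ℂ) ⊗ₜ[ℝ] H)) X) Y =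
      B.herm X ((Complex.I • LieAlgebra.ad ℂ (ℂ ⊗[ℝ] L) ((1 : ℂ) ⊗ₜ[ℝ] H)) Y) := by
  simp [B.herm_lie]

variable [FiniteDimensional ℝ L]

theorem exists_form_eq (s : Submodule ℝ L) (φ : s →ₗ[ℝ] ℝ) :
    ∃ α ∈ s, ∀ H : s, B.form α H = φ H := by
  have hinj : Function.Injective (B.form.domRestrict₁₂ s s) :=
    (injective_iff_map_eq_zero _).mpr fun x hx =>
      Subtype.ext (B.eq_zero_of_form_self_eq_zero (DFunLike.congr_fun hx x))
  obtain ⟨α, hα⟩ := (LinearMap.injective_iff_surjective_of_finrank_eq_finrank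
    (Subspace.dual_finrank_eq (K := ℝ) (V := s)).symm).mp hinj φ
  exact ⟨α, α.2, fun H => DFunLike.congr_fun hα H⟩

theorem exists_iInf_eigenspace_le_rootSpace {ι : Type*} (b : Module.Basis ι ℝ s) (r : ι → ℝ) :
    ∃ α ∈ s, ⨅ i, Module.End.eigenspace
      (Complex.I • LieAlgebra.ad ℂ (ℂ ⊗[ℝ] L) ((1 : ℂ) ⊗ₜ[ℝ] (b i : L))) (r i : ℂ) ≤
        rootSpace B s α := by
  obtain ⟨α, hα, form_eq⟩ := exists_form_eq B s (b.constr ℝ fun i => -r i)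
  refine ⟨α, hα, fun X hX => ?_⟩
  have hspan : Submodule.span ℝ (Set.range fun i => (b i : L)) = s := by
    rw [Set.range_comp' Subtype.val b, ← Submodule.coe_subtype, ← Submodule.map_span, b.span_eq,
      Submodule.map_subtype_top]
  rw [← hspan, mem_rootSpace_span]
  rintro _ ⟨i, rfl⟩
  have hi := Module.End.mem_eigenspace_iff.mp ((Submodule.mem_iInf _).mp hX i)
  rw [LinearMap.smul_apply, LieAlgebra.ad_apply] at hi
  rw [form_eq, b.constr_basis, Complex.ofReal_neg, mul_neg, ← neg_mul, mul_smul, ← hi, smul_smul,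
    neg_mul, Complex.I_mul_I, neg_neg, one_smul]

theorem iSup_rootSpace_eq_top (hs : ∀ x ∈ s, ∀ y ∈ s, ⁅x, y⁆ = 0) :
    ⨆ α : s, rootSpace B s (α : L) = ⊤ := by
  let := B.hermCore.toNormedAddCommGroup
  let : InnerProductSpace ℂ (ℂ ⊗[ℝ] L) := InnerProductSpace.ofCore B.hermCore.toCore
  let b := Module.finBasis ℝ s
  let T i : Module.End ℂ (ℂ ⊗[ℝ] L) :=
    Complex.I • LieAlgebra.ad ℂ (ℂ ⊗[ℝ] L) ((1 : ℂ) ⊗ₜ[ℝ] (b i : L))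
  have hsymm : ∀ i, (T i).IsSymmetric := fun i => herm_I_smul_ad B (b i)
  have hcomm : Pairwise (Function.onFun Commute T) := fun i j _ =>
    ((commute_ad_tmul (hs _ (b i).2 _ (b j).2)).smul_left _).smul_right _
  rw [eq_top_iff, ← LinearMap.IsSymmetric.iSup_iInf_eq_top_of_commute hsymm hcomm]
  refine iSup_le fun c => ?_
  rcases eq_or_ne (⨅ i, Module.End.eigenspace (T i) (c i)) ⊥ with hbot | hbot
  · exact hbot.trans_le bot_le
  have hreal : ∀ i, c i = ((c i).re : ℂ) := fun i => by
    refine (Complex.conj_eq_iff_re.mp ((hsymm i).conj_eigenvalue_eq_self fun h => hbot ?_)).symm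
    exact le_bot_iff.mp ((iInf_le _ i).trans h.le)
  obtain ⟨α, hα, hle⟩ := exists_iInf_eigenspace_le_rootSpace B b fun i => (c i).re
  simp only [← hreal] at hle
  exact hle.trans (le_iSup (fun α : s => rootSpace B s (α : L)) ⟨α, hα⟩)

end Spanning

section Fiber

theorem eq_iSup_fiber_of_iSup_eq_top {α ι κ : Type*} [CompleteLattice α] [IsModularLattice α]
    {U : ι → α} {V : κ → α} (hU : ⨆ i, U i = ⊤) (hV : iSupIndep V) {f : ι → κ}
    (hUV : ∀ i, U i ≤ V (f i)) (k : κ) : V k = ⨆ (i) (_ : f i = k), U i := by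
  have fiber_le : ⨆ (i) (_ : f i = k), U i ≤ V k := iSup₂_le fun i hi => hi ▸ hUV i
  have le_sup : ⊤ ≤ (⨆ (i) (_ : f i = k), U i) ⊔ ⨆ (j) (_ : j ≠ k), V j := by
    rw [← hU]
    refine iSup_le fun i => ?_
    rcases eq_or_ne (f i) k with hi | hi
    · exact le_sup_of_le_left (le_iSup₂ (f := fun i (_ : f i = k) => U i) i hi)
    · exact le_sup_of_le_right ((hUV i).trans (le_iSup₂ (f := fun j (_ : j ≠ k) => V j) (f i) hi))
  refine (eq_of_le_of_inf_le_of_le_sup fiber_le ?_ (le_top.trans le_sup)).symm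
  rw [(hV k).eq_bot]
  exact bot_le

end Fiber

section Projection

variable {L : Type*} [LieRing L] [LieAlgebra ℝ L] [FiniteDimensional ℝ L]

namespace InvariantInnerProduct

variable (B : InvariantInnerProduct L) {a : Submodule ℝ L} {H x l : L}

theorem proj_mem (a : Submodule ℝ L) (x : L) : B.proj a x ∈ a :=
  Submodule.projection_apply_mem _ x

theorem form_proj (hH : H ∈ a) (x : L) : B.form (B.proj a x) H = B.form x H := by
  have mem_orthogonal : x - B.proj a x ∈ B.form.orthogonal a := by
    rw [proj, Submodule.projection_eq_self_sub_projection (B.isCompl a).symm, sub_sub_cancel]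
    exact Submodule.projection_apply_mem _ x
  rw [← sub_eq_zero, ← LinearMap.map_sub₂, B.symm, ← neg_sub, map_neg, neg_eq_zero]
  exact mem_orthogonal H hH

theorem proj_eq_iff (hl : l ∈ a) :
    B.proj a x = l ↔ ∀ H ∈ a, B.form x H = B.form l H := by
  refine ⟨?_, fun h => ?_⟩
  · rintro rfl H hH
    exact (B.form_proj hH x).symm
  · exact B.eq_of_forall_form_eq (B.proj_mem a x) hl fun H hH => by rw [B.form_proj hH, h H hH]

end InvariantInnerProduct

variable {B : InvariantInnerProduct L} {t a : Submodule ℝ L}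

theorem rootSpace_le_rootSpace_proj (hat : a ≤ t) (α : L) :
    rootSpace B t α ≤ rootSpace B a (B.proj a α) :=
  rootSpace_le_rootSpace hat fun _ hH => (B.form_proj hH α).symm

theorem rootSpace_eq_iSup (ht : ∀ x ∈ t, ∀ y ∈ t, ⁅x, y⁆ = 0) (hat : a ≤ t) {l : L}
    (hl : l ∈ a) :
    rootSpace B a l = ⨆ (α : t) (_ : B.proj a α = l), rootSpace B t (α : L) := by
  simpa only [Subtype.mk.injEq] using
    eq_iSup_fiber_of_iSup_eq_top (iSup_rootSpace_eq_top B ht)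
      (iSupIndep_rootSpace B (s := a) subset_rfl)
      (f := fun α : t => ⟨B.proj a α, B.proj_mem a α⟩)
      (fun α => rootSpace_le_rootSpace_proj hat α) ⟨l, hl⟩

variable (B t a) in
/-- The roots of `𝔱` over the element `l` of `𝔞`, that is, those whose orthogonal projection to `𝔞`
is `l`. -/
def rootsOver (l : L) : Set L := {α | α ∈ roots B t ∧ B.proj a α = l}

theorem rootSpace_eq_iSup_rootsOver (ht : ∀ x ∈ t, ∀ y ∈ t, ⁅x, y⁆ = 0) (hat : a ≤ t) {l : L}
    (hl : l ∈ a) (hl0 : l ≠ 0) :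
    rootSpace B a l = ⨆ α : rootsOver B t a l, rootSpace B t (α : L) := by
  refine le_antisymm ?_ (iSup_le fun α => (rootSpace_le_rootSpace_proj hat α).trans_eq
    (congrArg (rootSpace B a) α.2.2))
  rw [rootSpace_eq_iSup ht hat hl]
  refine iSup₂_le fun α hα => ?_
  rcases eq_or_ne (rootSpace B t (α : L)) ⊥ with hbot | hbot
  · exact hbot.trans_le bot_le
  · have hα0 : (α : L) ≠ 0 := fun h => hl0 (by rw [← hα, h, map_zero])
    exact le_iSup (fun α : rootsOver B t a l => rootSpace B t (α : L)) ⟨α, ⟨α.2, hα0, hbot⟩, hα⟩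

end Projection

section Counting

theorem setOf_ne_zero_eq_image_union {X Y : Type*} {f : X → Y} {S N C : Set X} {R : Set Y}
    (hS : S.Finite) (hSR : Set.MapsTo f S R) (hNS : N ⊆ S) (hCS : C ⊆ S) {d : Y → ℕ}
    (hd : ∀ y ∈ R, 2 * d y = 2 * {x ∈ N | f x = y}.ncard + {x ∈ C | f x = y}.ncard) :
    {y ∈ R | d y ≠ 0} = f '' N ∪ f '' C := by
  have ne_zero_iff : ∀ y ∈ R, d y ≠ 0 ↔ y ∈ f '' N ∪ f '' C := fun y hy => by
    rw [Set.mem_union, ← Set.fiber_ncard_ne_zero_iff_mem_image (hS.subset hNS),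
      ← Set.fiber_ncard_ne_zero_iff_mem_image (hS.subset hCS)]
    have := hd y hy
    omega
  refine Set.ext fun y => ⟨fun hy => (ne_zero_iff y hy.1).mp hy.2, fun hy => ?_⟩
  have hyR : y ∈ R := by
    rcases hy with ⟨x, hx, rfl⟩ | ⟨x, hx, rfl⟩
    exacts [hSR (hNS hx), hSR (hCS hx)]
  exact ⟨hyR, (ne_zero_iff y hyR).mpr hy⟩

theorem finrank_eigenspace_restrict {K V : Type*} [CommRing K] [AddCommGroup V] [Module K V]
    (T : Module.End K V) {U : Submodule K V} (hU : ∀ x ∈ U, T x ∈ U) (ε : K) :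
    Module.finrank K (Module.End.eigenspace (T.restrict hU) ε) =
      Module.finrank K (U ⊓ T.eigenspace ε : Submodule K V) := by
  rw [Module.End.eigenspace, Module.End.eigenspace, Submodule.inf_genEigenspace T U hU,
    Submodule.finrank_map_subtype_eq]

variable {K V ι : Type*} [Field K] [AddCommGroup V] [Module K V]
  {T : Module.End K V} {ε : K}

theorem isProj_eigenspace [NeZero (2 : K)] (hT : T * T = 1) (hε : ε * ε = 1) :
    LinearMap.IsProj (T.eigenspace ε) ((2⁻¹ : K) • (1 + ε • T)) where
  map_mem x := by
    have hTx : T (T x) = x := DFunLike.congr_fun hT x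
    simp only [Module.End.mem_eigenspace_iff, LinearMap.smul_apply, LinearMap.add_apply,
      Module.End.one_apply, map_smul, map_add, hTx, smul_add, smul_comm ε (2⁻¹ : K), smul_smul ε ε,
      hε, one_smul, add_comm]
  map_id x hx := by
    rw [LinearMap.smul_apply, LinearMap.add_apply, LinearMap.smul_apply, Module.End.one_apply,
      Module.End.mem_eigenspace_iff.mp hx, smul_smul, hε, one_smul, ← two_smul K x, smul_smul,
      inv_mul_cancel₀ two_ne_zero, one_smul]

theorem two_mul_finrank_eigenspace_eq_trace [NeZero (2 : K)] [FiniteDimensional K V]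
    (hT : T * T = 1) (hε : ε * ε = 1) :
    2 * (Module.finrank K (T.eigenspace ε) : K) =
      Module.finrank K V + ε * LinearMap.trace K V T := by
  rw [← (isProj_eigenspace hT hε).trace, map_smul, map_add, map_smul, LinearMap.trace_one,
    smul_eq_mul, smul_eq_mul, mul_inv_cancel_left₀ two_ne_zero]

variable [CharZero K]

open Classical in
theorem one_add_mul_repr_apply_self (b : Module.Basis ι K V) (hT : T * T = 1)
    {p : ι → ι} {c : ι → K} (hb : ∀ i, T (b i) = c i • b (p i)) (hε : ε * ε = 1) (i : ι) :
    1 + ε * b.repr (T (b i)) i =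
      2 * (if T (b i) = ε • b i then 1 else 0) + if p i ≠ i then 1 else 0 := by
  have repr_apply : b.repr (T (b i)) i = if p i = i then c i else 0 := by
    simp [hb, Finsupp.single_apply]
  have hε0 : ε ≠ 0 := left_ne_zero_of_mul_eq_one hε
  by_cases hi : p i = i
  · have hTb : T (b i) = c i • b i := by rw [hb, hi]
    have hcc : c i * c i = 1 := by
      have h : T (T (b i)) = b i := DFunLike.congr_fun hT (b i)
      rw [hTb, map_smul, hTb, smul_smul] at h
      simpa using congrArg (b.repr · i) h
    have apply_eq_iff : T (b i) = ε • b i ↔ c i = ε := by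
      rw [hTb]
      exact smul_left_inj (b.ne_zero i)
    rcases mul_self_eq_mul_self_iff.mp (hcc.trans hε.symm) with hc | hc
    · simp [repr_apply, apply_eq_iff, hi, hc, hε, one_add_one_eq_two]
    · simp [repr_apply, apply_eq_iff, hi, hc, hε, neg_eq_self, hε0]
  · have hne : T (b i) ≠ ε • b i := fun h => hε0 (by
      simpa [repr_apply, hi] using (congrArg (b.repr · i) h).symm)
    simp [repr_apply, hi, hne]

open Classical in
theorem two_mul_finrank_eigenspace [Finite ι] (b : Module.Basis ι K V) (hT : T * T = 1)
    {p : ι → ι} {c : ι → K} (hb : ∀ i, T (b i) = c i • b (p i)) (hε : ε * ε = 1) :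
    2 * Module.finrank K (T.eigenspace ε) =
      2 * Nat.card {i // T (b i) = ε • b i} + Nat.card {i // p i ≠ i} := by
  have := Fintype.ofFinite ι
  have : FiniteDimensional K V := b.finiteDimensional_of_finite
  have diagonal_entry := fun i => one_add_mul_repr_apply_self b hT hb hε i
  have h := two_mul_finrank_eigenspace_eq_trace hT hε
  rw [LinearMap.trace_eq_matrix_trace K b, Module.finrank_eq_card_basis b, Matrix.trace,
    Finset.mul_sum, Fintype.card_eq_sum_ones, Nat.cast_sum, ← Finset.sum_add_distrib] at h
  simp only [Nat.cast_one, Matrix.diag_apply, LinearMap.toMatrix_apply, diagonal_entry] at h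
  rw [Finset.sum_add_distrib, ← Finset.mul_sum, Finset.sum_boole, Finset.sum_boole] at h
  rw [Nat.card_eq_fintype_card, Nat.card_eq_fintype_card, Fintype.card_subtype,
    Fintype.card_subtype]
  exact_mod_cast h

theorem two_mul_finrank_iSup_inf_eigenspace [Finite ι] {U : ι → Submodule K V}
    (hU : iSupIndep U) (hU1 : ∀ i, Module.finrank K (U i) = 1) (hT : T * T = 1) {p : ι → ι}
    (hp : ∀ i, ∀ x ∈ U i, T x ∈ U (p i)) (hε : ε * ε = 1) :
    2 * Module.finrank K ((⨆ i, U i) ⊓ T.eigenspace ε : Submodule K V) =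
      2 * Nat.card {i // U i ≤ T.eigenspace ε} + Nat.card {i // p i ≠ i} := by
  choose e he0 he using fun i => finrank_eq_one_iff'.mp (hU1 i)
  have span_e : ∀ i, U i = Submodule.span K {(e i : V)} := fun i => by
    refine le_antisymm (fun x hx => ?_) (by simp)
    obtain ⟨c, hc⟩ := he i ⟨x, hx⟩
    exact Submodule.mem_span_singleton.mpr ⟨c, congrArg Subtype.val hc⟩
  have iSup_U : Submodule.span K (Set.range fun i => (e i : V)) = ⨆ i, U i := by
    rw [Submodule.span_range_eq_iSup]
    exact iSup_congr fun i => (span_e i).symm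
  have linearIndependent_e : LinearIndependent K fun i => (e i : V) :=
    hU.linearIndependent U (fun i => (e i).2) fun i h => he0 i (Subtype.ext h)
  have map_mem : ∀ x ∈ ⨆ i, U i, T x ∈ ⨆ i, U i := fun x hx =>
    (iSup_le fun i x hx => le_iSup U (p i) (hp i x hx) : ⨆ i, U i ≤ (⨆ i, U i).comap T) hx
  have smul_e : ∀ i, ∃ c : K, c • (e (p i) : V) = T (e i) := fun i => by
    rw [← Submodule.mem_span_singleton, ← span_e]
    exact hp i _ (e i).2
  choose c hc using smul_e
  let b := (Module.Basis.span linearIndependent_e).map (LinearEquiv.ofEq _ _ iSup_U)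
  have hb : ∀ i, (b i : V) = e i := fun i => by simp [b, Module.Basis.span_apply]
  have key := two_mul_finrank_eigenspace b (T := T.restrict map_mem)
    (LinearMap.ext fun x => Subtype.ext (DFunLike.congr_fun hT (x : V)))
    (p := p) (c := c) (fun i => Subtype.ext (by simp [hb, hc])) hε
  simpa [Module.End.mem_eigenspace_iff, finrank_eigenspace_restrict, span_e, Subtype.ext_iff, hb]
    using key

end Counting

section Schur

theorem eigenspace_eq_top_of_isSimple {R L : Type*} [CommRing R] [LieRing L] [LieAlgebra R L]
    (hsimple : LieAlgebra.IsSimple R L) {S : Module.End R L} (hS : ∀ x y : L, S ⁅x, y⁆ = ⁅x, S y⁆)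
    {c : R} (hc : S.eigenspace c ≠ ⊥) : S.eigenspace c = ⊤ := by
  let I : LieIdeal R L :=
    { S.eigenspace c with
      lie_mem := fun {x y} hy => Module.End.mem_eigenspace_iff.mpr <| by
        rw [hS, Module.End.mem_eigenspace_iff.mp hy, lie_smul] }
  have hI : I.toSubmodule = S.eigenspace c := rfl
  rcases hsimple.eq_bot_or_eq_top I with h | h
  · exact absurd (by rw [← hI, h, LieSubmodule.bot_toSubmodule]) hc
  · rw [← hI, h, LieSubmodule.top_toSubmodule]

variable {L : Type*} [LieRing L] [LieAlgebra ℝ L] (B : InvariantInnerProduct L)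

/-- An invariant inner product as a real inner product, giving access to the spectral theorem. -/
@[reducible]
def InvariantInnerProduct.core : InnerProductSpace.Core ℝ L where
  inner x y := B.form x y
  conj_inner_symm x y := B.symm y x
  re_inner_nonneg x := B.form_self_nonneg x
  add_left x y z := by simp
  smul_left x y c := by simp
  definite _ h := B.eq_zero_of_form_self_eq_zero h

variable [FiniteDimensional ℝ L]

theorem exists_eigenspace_ne_bot [Nontrivial L] {S : Module.End ℝ L}
    (hS : ∀ x y, B.form (S x) y = B.form x (S y)) : ∃ c : ℝ, S.eigenspace c ≠ ⊥ := by
  let := B.core.toNormedAddCommGroup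
  let : InnerProductSpace ℝ L := InnerProductSpace.ofCore B.core.toCore
  have hsymm : LinearMap.IsSymmetric S := hS
  by_contra! h
  have horth := hsymm.orthogonalComplement_iSup_eigenspaces_eq_bot
  simp only [h, iSup_bot, Submodule.bot_orthogonal_eq_top, top_ne_bot] at horth

theorem exists_eq_smul_form (hsimple : LieAlgebra.IsSimple ℝ L) {ψ : LinearMap.BilinForm ℝ L}
    (hsymm : ∀ x y, ψ x y = ψ y x) (hinv : ∀ x y z : L, ψ ⁅x, y⁆ z = -ψ y ⁅x, z⁆) :
    ∃ c : ℝ, ψ = c • B.form := by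
  have : Nontrivial L := by
    by_contra h
    rw [not_nontrivial_iff_subsingleton] at h
    exact hsimple.non_abelian ⟨fun _ _ => Subsingleton.elim _ _⟩
  have hnondeg : B.form.Nondegenerate :=
    ⟨fun x h => B.eq_zero_of_form_self_eq_zero (h x),
      fun x h => B.eq_zero_of_form_self_eq_zero (h x)⟩
  let S : Module.End ℝ L := (B.form.toDual hnondeg).symm ∘ₗ ψ
  have form_S : ∀ x y, B.form (S x) y = ψ x y := fun x y =>
    LinearMap.BilinForm.apply_toDual_symm_apply (hB := hnondeg) ..
  have S_symm : ∀ x y, B.form (S x) y = B.form x (S y) := fun x y => by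
    rw [form_S, B.symm x, form_S, hsymm]
  have S_lie : ∀ x y, S ⁅x, y⁆ = ⁅x, S y⁆ := fun x y =>
    B.eq_of_forall_form_eq (s := ⊤) trivial trivial fun z _ => by
      rw [form_S, B.invariant, hinv, form_S]
  obtain ⟨c, hc⟩ := exists_eigenspace_ne_bot B S_symm
  refine ⟨c, LinearMap.ext₂ fun x y => ?_⟩
  have S_x : S x = c • x := Module.End.mem_eigenspace_iff.mp <| by
    rw [eigenspace_eq_top_of_isSimple hsimple S_lie hc]
    trivial
  rw [← form_S, S_x, map_smul]
  rfl

end Schur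

section LieInvolution

/-- An involutive automorphism of a Lie algebra. -/
structure IsLieInvolution {R L : Type*} [CommRing R] [LieRing L] [LieAlgebra R L]
    (θ : Module.End R L) : Prop where
  map_lie : ∀ x y, θ ⁅x, y⁆ = ⁅θ x, θ y⁆
  mul_self : θ * θ = 1

namespace IsLieInvolution

section CommRing

variable {R L : Type*} [CommRing R] [LieRing L] [LieAlgebra R L] {θ θ₁ θ₂ : Module.End R L}

theorem apply_apply (hθ : IsLieInvolution θ) (x : L) : θ (θ x) = x :=
  DFunLike.congr_fun hθ.mul_self x

theorem mul (h₁ : IsLieInvolution θ₁) (h₂ : IsLieInvolution θ₂) (hcomm : Commute θ₁ θ₂) :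
    IsLieInvolution (θ₁ * θ₂) where
  map_lie x y := by simp only [Module.End.mul_apply, h₁.map_lie, h₂.map_lie]
  mul_self := by rw [hcomm.symm.mul_mul_mul_comm, h₁.mul_self, h₂.mul_self, one_mul]

end CommRing

variable {L : Type*} [LieRing L] [LieAlgebra ℝ L] {θ : Module.End ℝ L}

theorem form_map_map [FiniteDimensional ℝ L] (hθ : IsLieInvolution θ)
    (hsimple : LieAlgebra.IsSimple ℝ L) (B : InvariantInnerProduct L) (x y : L) :
    B.form (θ x) (θ y) = B.form x y := by
  obtain ⟨c, hc⟩ := exists_eq_smul_form B hsimple (ψ := B.form.compl₁₂ θ θ)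
    (fun x y => B.symm (θ x) (θ y)) (fun x y z => by simp [hθ.map_lie, B.invariant])
  have form_map : ∀ x y, B.form (θ x) (θ y) = c * B.form x y := LinearMap.congr_fun₂ hc
  rcases eq_or_ne x 0 with rfl | hx
  · simp
  have hpos : 0 < B.form x x := B.pos x hx
  have c_mul_self : c * c = 1 := by
    have h := form_map (θ x) (θ x)
    rw [hθ.apply_apply, form_map, ← mul_assoc] at h
    exact (eq_div_of_mul_eq hpos.ne' h.symm).trans (div_self hpos.ne')
  have c_nonneg : 0 ≤ c :=
    nonneg_of_mul_nonneg_left ((B.form_self_nonneg _).trans_eq (form_map x x)) hpos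
  rw [form_map, (mul_self_eq_one_iff.mp c_mul_self).resolve_right (by linarith), one_mul]

theorem map_mem_of_isMaximalAbelian (hθ : IsLieInvolution θ) {t : Submodule ℝ L}
    (ht : IsMaximalAbelian ⊤ t) (htm : IsMaximalAbelian (mSpace θ) (t ⊓ mSpace θ)) {x : L}
    (hx : x ∈ t) : θ x ∈ t := by
  have sub_mem_mSpace : x - θ x ∈ mSpace θ := by
    rw [mSpace, Module.End.mem_eigenspace_iff, map_sub, hθ.apply_apply, neg_one_smul, neg_sub]
  have sub_mem_inf : x - θ x ∈ t ⊓ mSpace θ :=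
    htm.mem_of_forall_lie_eq_zero sub_mem_mSpace fun H hH => by
      have lie_x : ⁅H, x⁆ = 0 := ht.prop.2 H hH.1 x hx
      have map_H : θ H = -H := by simpa using Module.End.mem_eigenspace_iff.mp hH.2
      have lie_map_x : ⁅H, θ x⁆ = 0 := by
        rw [← neg_eq_zero, ← neg_lie, ← map_H, ← hθ.map_lie, lie_x, map_zero]
      rw [lie_sub, lie_x, lie_map_x, sub_zero]
  simpa using t.sub_mem hx sub_mem_inf.1

end IsLieInvolution

variable {L : Type*} [LieRing L] [LieAlgebra ℝ L] {θ₁ θ₂ : Module.End ℝ L}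

theorem IsAdaptedTorus.mul_apply_mem {t : Submodule ℝ L} (ht : IsAdaptedTorus θ₁ θ₂ t)
    (h₁ : IsLieInvolution θ₁) (h₂ : IsLieInvolution θ₂) : ∀ x ∈ t, (θ₁ * θ₂) x ∈ t := fun _ hx =>
  h₁.map_mem_of_isMaximalAbelian ht.maximal ht.maximal_left
    (h₂.map_mem_of_isMaximalAbelian ht.maximal ht.maximal_right hx)

theorem eigenspace_mul_eq_sup (h₁ : θ₁ * θ₁ = 1) (hcomm : Commute θ₁ θ₂) (ε : ℝ) :
    (θ₁ * θ₂).eigenspace ε =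
      (kSpace θ₁ ⊓ θ₂.eigenspace ε) ⊔ (mSpace θ₁ ⊓ θ₂.eigenspace (-ε)) := by
  have h11 : ∀ x, θ₁ (θ₁ x) = x := fun x => DFunLike.congr_fun h₁ x
  have h12 : ∀ x, θ₁ (θ₂ x) = θ₂ (θ₁ x) := fun x => DFunLike.congr_fun hcomm x
  refine le_antisymm (fun x hx => ?_) (sup_le ?_ ?_)
  · have hx1 : θ₁ (θ₂ x) = ε • x := Module.End.mem_eigenspace_iff.mp hx
    have hx2 : θ₂ x = ε • θ₁ x := by rw [← h11 (θ₂ x), hx1, map_smul]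
    rw [h12] at hx1
    have hdec : x = (1 / 2 : ℝ) • (x + θ₁ x) + (1 / 2 : ℝ) • (x - θ₁ x) := by module
    rw [hdec]
    refine Submodule.add_mem_sup (Submodule.smul_mem _ _ ⟨?_, ?_⟩)
      (Submodule.smul_mem _ _ ⟨?_, ?_⟩) <;>
    refine Module.End.mem_eigenspace_iff.mpr ?_
    · rw [map_add, h11]; module
    · rw [map_add, hx1, hx2]; module
    · rw [map_sub, h11]; module
    · rw [map_sub, hx1, hx2]; module
  · rintro x ⟨hx, hx'⟩
    have hx1 : θ₁ x = (1 : ℝ) • x := Module.End.mem_eigenspace_iff.mp hx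
    have hx2 : θ₂ x = ε • x := Module.End.mem_eigenspace_iff.mp hx'
    exact Module.End.mem_eigenspace_iff.mpr <| by
      rw [Module.End.mul_apply, hx2, map_smul, hx1, one_smul]
  · rintro x ⟨hx, hx'⟩
    have hx1 : θ₁ x = (-1 : ℝ) • x := Module.End.mem_eigenspace_iff.mp hx
    have hx2 : θ₂ x = (-ε) • x := Module.End.mem_eigenspace_iff.mp hx'
    exact Module.End.mem_eigenspace_iff.mpr <| by
      rw [Module.End.mul_apply, hx2, map_smul, hx1, smul_smul, neg_mul_neg, mul_one]

end LieInvolution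

section DifferentialInvolution

variable {E : Type*} [NormedAddCommGroup E] [NormedSpace ℝ E]
  {G : Type*} [TopologicalSpace G] [ChartedSpace E G] [Group G] [LieGroup 𝓘(ℝ, E) ∞ G]

theorem IsInvolution.isLieInvolution_differential [CompleteSpace E] {Θ : G ≃* G}
    (hΘ : IsInvolution E Θ) : IsLieInvolution (differential E Θ) where
  map_lie := differential_lie hΘ.contMDiff <| by
    rw [show Θ.symm = Θ from MulEquiv.ext fun g => Θ.symm_apply_eq.mpr (hΘ.apply_apply g).symm]
    exact hΘ.contMDiff
  mul_self := by
    rw [← differential_trans hΘ.contMDiff hΘ.contMDiff, ← differential_refl]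
    exact congrArg (differential E) (MulEquiv.ext hΘ.apply_apply)

theorem commute_differential {Θ₁ Θ₂ : G ≃* G}
    (h₁ : ContMDiff 𝓘(ℝ, E) 𝓘(ℝ, E) ∞ Θ₁) (h₂ : ContMDiff 𝓘(ℝ, E) 𝓘(ℝ, E) ∞ Θ₂)
    (hcomm : ∀ g, Θ₁ (Θ₂ g) = Θ₂ (Θ₁ g)) :
    Commute (differential E Θ₁) (differential E Θ₂) := by
  rw [commute_iff_eq, ← differential_trans h₁ h₂, ← differential_trans h₂ h₁]
  exact congrArg (differential E) (MulEquiv.ext hcomm)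

end DifferentialInvolution

section RootInvolution

attribute [local instance] complexBracket

variable {L : Type*} [LieRing L] [LieAlgebra ℝ L]

theorem eigenspace_baseChange (σ : Module.End ℝ L) (ε : ℝ) :
    Module.End.eigenspace (σ.baseChange ℂ) (ε : ℂ) = (σ.eigenspace ε).baseChange ℂ := by
  refine le_antisymm (fun X hX => ?_) ?_
  · obtain ⟨x, y, rfl⟩ := exists_eq_tmul_add_I_smul_tmul X
    rw [Module.End.mem_eigenspace_iff, map_add, map_smul, LinearMap.baseChange_tmul,
      LinearMap.baseChange_tmul, smul_add, smul_comm (ε : ℂ), ← tmul_ofReal_smul,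
      ← tmul_ofReal_smul, tmul_add_I_smul_tmul_inj] at hX
    exact add_mem
      (Submodule.tmul_mem_baseChange_of_mem 1 (Module.End.mem_eigenspace_iff.mpr hX.1))
      (Submodule.smul_mem _ _
        (Submodule.tmul_mem_baseChange_of_mem 1 (Module.End.mem_eigenspace_iff.mpr hX.2)))
  · rw [Submodule.baseChange_eq_span, Submodule.span_le]
    rintro _ ⟨x, hx, rfl⟩
    refine Module.End.mem_eigenspace_iff.mpr ?_
    rw [TensorProduct.mk_apply, LinearMap.baseChange_tmul, Module.End.mem_eigenspace_iff.mp hx,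
      tmul_ofReal_smul]

variable {B : InvariantInnerProduct L} {t a : Submodule ℝ L} {σ : Module.End ℝ L} {α : L}

namespace IsLieInvolution

theorem baseChange_lie (hσ : IsLieInvolution σ) (X Y : ℂ ⊗[ℝ] L) :
    σ.baseChange ℂ ⁅X, Y⁆ = ⁅σ.baseChange ℂ X, σ.baseChange ℂ Y⁆ :=
  (LieAlgebra.ExtendScalars.map (AlgHom.id ℝ ℂ) (⟨σ, hσ.map_lie _ _⟩ : L →ₗ⁅ℝ⁆ L)).map_lie X Y

theorem baseChange_mul_self (hσ : IsLieInvolution σ) :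
    σ.baseChange ℂ * σ.baseChange ℂ = 1 := by
  rw [← LinearMap.baseChange_mul, hσ.mul_self, LinearMap.baseChange_one]

theorem baseChange_mem_rootSpace (hσ : IsLieInvolution σ)
    (hform : ∀ x y, B.form (σ x) (σ y) = B.form x y) (hσt : ∀ x ∈ t, σ x ∈ t) {X : ℂ ⊗[ℝ] L}
    (hX : X ∈ rootSpace B t α) : σ.baseChange ℂ X ∈ rootSpace B t (σ α) :=
  mem_rootSpace.mpr fun H hH => by
    have h := congrArg (σ.baseChange ℂ) (mem_rootSpace.mp hX (σ H) (hσt H hH))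
    rwa [hσ.baseChange_lie, LinearMap.baseChange_tmul, hσ.apply_apply, map_smul, ← hform α,
      hσ.apply_apply] at h

theorem map_mem_roots (hσ : IsLieInvolution σ)
    (hform : ∀ x y, B.form (σ x) (σ y) = B.form x y) (hσt : ∀ x ∈ t, σ x ∈ t)
    (hα : α ∈ roots B t) : σ α ∈ roots B t := by
  refine ⟨hσt α hα.1, fun h => hα.2.1 ?_, fun hbot => hα.2.2 (eq_bot_iff.mpr fun X hX => ?_)⟩
  · rw [← hσ.apply_apply α, h, map_zero]
  · have map_X : σ.baseChange ℂ X = 0 := by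
      simpa only [hbot, Submodule.mem_bot] using hσ.baseChange_mem_rootSpace hform hσt hX
    have apply_apply_X := DFunLike.congr_fun hσ.baseChange_mul_self X
    rwa [Module.End.mul_apply, map_X, map_zero, eq_comm] at apply_apply_X

end IsLieInvolution

theorem finrank_rootSpace_eq_one (ht : IsMaximalAbelian ⊤ t) (hα : α ∈ roots B t) :
    Module.finrank ℂ (rootSpace B t α) = 1 := by
  obtain ⟨E, hE, hE0⟩ := Submodule.exists_mem_ne_zero_of_ne_bot hα.2.2
  rw [rootSpace_eq_span_singleton ht hα.1 hα.2.1 hE hE0, finrank_span_singleton hE0]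

variable [FiniteDimensional ℝ L]

variable (B t) in
theorem finite_roots : (roots B t).Finite :=
  WellFoundedGT.finite_of_iSupIndep (iSupIndep_rootSpace B fun _ hα => hα.1) fun α => α.2.2.2

theorem proj_map_eq (hform : ∀ x y, B.form (σ x) (σ y) = B.form x y)
    (hσa : ∀ x ∈ a, σ x = x) (x : L) : B.proj a (σ x) = B.proj a x :=
  (B.proj_eq_iff (B.proj_mem a x)).mpr fun H hH => by
    rw [B.form_proj hH, ← hform x H, hσa H hH]

theorem two_mul_finrank_rootSpace_inf_eigenspace (ht : IsMaximalAbelian ⊤ t) (hat : a ≤ t)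
    (hσ : IsLieInvolution σ) (hform : ∀ x y, B.form (σ x) (σ y) = B.form x y)
    (hσt : ∀ x ∈ t, σ x ∈ t) (hσa : ∀ x ∈ a, σ x = x) {l : L} (hl : l ∈ a) (hl0 : l ≠ 0)
    {ε : ℂ} (hε : ε * ε = 1) :
    2 * Module.finrank ℂ
        (rootSpace B a l ⊓ Module.End.eigenspace (σ.baseChange ℂ) ε : Submodule ℂ (ℂ ⊗[ℝ] L)) =
      2 * {α ∈ rootsOver B t a l |
          rootSpace B t α ≤ Module.End.eigenspace (σ.baseChange ℂ) ε}.ncard +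
        {α ∈ rootsOver B t a l | σ α ≠ α}.ncard := by
  have : Finite (rootsOver B t a l) := (finite_roots B t).subset fun _ hα => hα.1
  let p (α : rootsOver B t a l) : rootsOver B t a l :=
    ⟨σ α, hσ.map_mem_roots hform hσt α.2.1, (proj_map_eq hform hσa α).trans α.2.2⟩
  rw [rootSpace_eq_iSup_rootsOver ht.prop.2 hat hl hl0,
    two_mul_finrank_iSup_inf_eigenspace (iSupIndep_rootSpace B fun _ hα => hα.1.1)
      (fun α => finrank_rootSpace_eq_one ht α.2.1)
      hσ.baseChange_mul_self (p := p)
      (fun α _ hX => hσ.baseChange_mem_rootSpace hform hσt hX) hε]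
  simp only [ne_eq, Subtype.ext_iff, p]
  refine congrArg₂ (2 * · + ·) ?_ ?_
  · exact Nat.card_congr (Equiv.subtypeSubtypeEquivSubtypeInter (· ∈ rootsOver B t a l)
      fun α => rootSpace B t α ≤ Module.End.eigenspace (σ.baseChange ℂ) ε)
  · exact Nat.card_congr (Equiv.subtypeSubtypeEquivSubtypeInter (· ∈ rootsOver B t a l)
      fun α => ¬σ α = α)

end RootInvolution

section Multiplicities

variable {L : Type*} [LieRing L] [LieAlgebra ℝ L] {θ₁ θ₂ : Module.End ℝ L} {t : Submodule ℝ L}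

theorem mul_apply_of_mem_aSpace {x : L} (hx : x ∈ aSpace θ₁ θ₂ t) : (θ₁ * θ₂) x = x := by
  have hx₁ : θ₁ x = (-1 : ℝ) • x := Module.End.mem_eigenspace_iff.mp hx.2.1
  have hx₂ : θ₂ x = (-1 : ℝ) • x := Module.End.mem_eigenspace_iff.mp hx.2.2
  rw [Module.End.mul_apply, hx₂, map_smul, hx₁, smul_smul, neg_one_mul, neg_neg, one_smul]

variable [FiniteDimensional ℝ L] {B : InvariantInnerProduct L} {l : L}

theorem rootsOver_aSpace (hl : l ∈ aSpace θ₁ θ₂ t) (hl0 : l ≠ 0) :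
    rootsOver B t (aSpace θ₁ θ₂ t) l =
      {α ∈ roots B t \ rootsZero B θ₁ θ₂ t | B.proj (aSpace θ₁ θ₂ t) α = l} := by
  refine Set.ext fun α => ⟨fun hα => ⟨⟨hα.1, fun hα0 => hl0 ?_⟩, hα.2⟩, fun hα => ⟨hα.1.1, hα.2⟩⟩
  refine B.eq_zero_of_form_self_eq_zero ?_
  rw [← (B.proj_eq_iff hl).mp hα.2 l hl, hα0.2 l hl]

theorem proj_mem_roots {α : L} (hα : α ∈ roots B t \ rootsZero B θ₁ θ₂ t) :
    B.proj (aSpace θ₁ θ₂ t) α ∈ roots B (aSpace θ₁ θ₂ t) := by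
  refine ⟨B.proj_mem _ α, fun h0 => hα.2 ⟨hα.1, fun H hH => ?_⟩, fun hbot => hα.1.2.2 ?_⟩
  · rw [← B.form_proj hH, h0, map_zero, LinearMap.zero_apply]
  · exact eq_bot_iff.mpr ((rootSpace_le_rootSpace_proj inf_le_left α).trans_eq hbot)

theorem two_mul_finrank_signedRootSpace (h₁ : IsLieInvolution θ₁) (h₂ : IsLieInvolution θ₂)
    (hcomm : Commute θ₁ θ₂)
    (hform : ∀ x y, B.form ((θ₁ * θ₂) x) ((θ₁ * θ₂) y) = B.form x y)
    (ht : IsMaximalAbelian ⊤ t) (hstable : ∀ x ∈ t, (θ₁ * θ₂) x ∈ t)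
    (hl : l ∈ roots B (aSpace θ₁ θ₂ t)) {ε : ℝ} (hε : ε * ε = 1) :
    2 * Module.finrank ℂ (signedRootSpace B θ₁ θ₂ (aSpace θ₁ θ₂ t) l ε) =
      2 * {α ∈ {α ∈ roots B t \ rootsZero B θ₁ θ₂ t | rootSpace B t α ≤
        ((kSpace θ₁ ⊓ θ₂.eigenspace ε) ⊔ (mSpace θ₁ ⊓ θ₂.eigenspace (-ε))).baseChange ℂ} |
          B.proj (aSpace θ₁ θ₂ t) α = l}.ncard +
        {α ∈ rootsCpx B θ₁ θ₂ t | B.proj (aSpace θ₁ θ₂ t) α = l}.ncard := by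
  have sep_comm : ∀ P : L → Prop, {α ∈ rootsOver B t (aSpace θ₁ θ₂ t) l | P α} =
      {α ∈ {α ∈ roots B t \ rootsZero B θ₁ θ₂ t | P α} | B.proj (aSpace θ₁ θ₂ t) α = l} :=
    fun P => by
      rw [rootsOver_aSpace hl.1 hl.2.1]
      exact Set.ext fun α => and_right_comm
  have sigma_sigma : ∀ α, sigmaMap θ₁ (sigmaMap θ₂ α) = (θ₁ * θ₂) α := fun α => by
    simp [sigmaMap]
  have count := two_mul_finrank_rootSpace_inf_eigenspace (B := B) (a := aSpace θ₁ θ₂ t)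
    (ε := ε) ht inf_le_left
    (h₁.mul h₂ hcomm) hform hstable (fun x hx => mul_apply_of_mem_aSpace hx) hl.1 hl.2.1
    (by exact_mod_cast hε)
  simp only [rootsCpx, sigma_sigma]
  rw [sep_comm, sep_comm] at count
  rwa [← eigenspace_mul_eq_sup h₁.mul_self hcomm, ← eigenspace_baseChange]

theorem two_mul_mMult (h₁ : IsLieInvolution θ₁) (h₂ : IsLieInvolution θ₂)
    (hcomm : Commute θ₁ θ₂)
    (hform : ∀ x y, B.form ((θ₁ * θ₂) x) ((θ₁ * θ₂) y) = B.form x y)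
    (ht : IsMaximalAbelian ⊤ t) (hstable : ∀ x ∈ t, (θ₁ * θ₂) x ∈ t)
    (hl : l ∈ roots B (aSpace θ₁ θ₂ t)) :
    2 * mMult B θ₁ θ₂ (aSpace θ₁ θ₂ t) l =
      2 * {α ∈ rootsCpt B θ₁ θ₂ t | B.proj (aSpace θ₁ θ₂ t) α = l}.ncard +
        {α ∈ rootsCpx B θ₁ θ₂ t | B.proj (aSpace θ₁ θ₂ t) α = l}.ncard := by
  have count := two_mul_finrank_signedRootSpace h₁ h₂ hcomm hform ht hstable hl (one_mul 1)
  rwa [Complex.ofReal_one] at count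

theorem two_mul_nMult (h₁ : IsLieInvolution θ₁) (h₂ : IsLieInvolution θ₂)
    (hcomm : Commute θ₁ θ₂)
    (hform : ∀ x y, B.form ((θ₁ * θ₂) x) ((θ₁ * θ₂) y) = B.form x y)
    (ht : IsMaximalAbelian ⊤ t) (hstable : ∀ x ∈ t, (θ₁ * θ₂) x ∈ t)
    (hl : l ∈ roots B (aSpace θ₁ θ₂ t)) :
    2 * nMult B θ₁ θ₂ (aSpace θ₁ θ₂ t) l =
      2 * {α ∈ rootsNoncpt B θ₁ θ₂ t | B.proj (aSpace θ₁ θ₂ t) α = l}.ncard +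
        {α ∈ rootsCpx B θ₁ θ₂ t | B.proj (aSpace θ₁ θ₂ t) α = l}.ncard := by
  have count := two_mul_finrank_signedRootSpace h₁ h₂ hcomm hform ht hstable hl
    (neg_mul_neg 1 1 |>.trans (one_mul 1))
  rwa [neg_neg, Complex.ofReal_neg, Complex.ofReal_one] at count

theorem sigmaSet_eq {a : Submodule ℝ L} :
    sigmaSet B θ₁ θ₂ a = {l ∈ roots B a | mMult B θ₁ θ₂ a l ≠ 0} := by
  simp only [sigmaSet, mMult, ne_eq, Submodule.finrank_eq_zero]

theorem wSet_eq {a : Submodule ℝ L} :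
    wSet B θ₁ θ₂ a = {l ∈ roots B a | nMult B θ₁ θ₂ a l ≠ 0} := by
  simp only [wSet, nMult, ne_eq, Submodule.finrank_eq_zero]

end Multiplicities

end

end SymmTriad

theorem mainTheorem8_general {L : Type*} [LieRing L] [LieAlgebra ℝ L] [FiniteDimensional ℝ L]
    (B : SymmTriad.InvariantInnerProduct L) {θ₁ θ₂ : Module.End ℝ L}
    (h₁ : SymmTriad.IsLieInvolution θ₁) (h₂ : SymmTriad.IsLieInvolution θ₂)
    (hcomm : Commute θ₁ θ₂) (hform : ∀ x y, B.form ((θ₁ * θ₂) x) ((θ₁ * θ₂) y) = B.form x y)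
    {t a : Submodule ℝ L} (ht : SymmTriad.IsMaximalAbelian ⊤ t)
    (hstable : ∀ x ∈ t, (θ₁ * θ₂) x ∈ t) (ha : a = SymmTriad.aSpace θ₁ θ₂ t) :
    SymmTriad.sigmaSet B θ₁ θ₂ a =
        B.proj a '' SymmTriad.rootsCpt B θ₁ θ₂ t ∪ B.proj a '' SymmTriad.rootsCpx B θ₁ θ₂ t ∧
      SymmTriad.wSet B θ₁ θ₂ a =
        B.proj a '' SymmTriad.rootsNoncpt B θ₁ θ₂ t ∪ B.proj a '' SymmTriad.rootsCpx B θ₁ θ₂ t ∧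
      ∀ l ∈ SymmTriad.roots B a,
        (SymmTriad.mMult B θ₁ θ₂ a l : ℚ) =
            ({α ∈ SymmTriad.rootsCpt B θ₁ θ₂ t | B.proj a α = l}.ncard : ℚ) +
              1 / 2 * ({β ∈ SymmTriad.rootsCpx B θ₁ θ₂ t | B.proj a β = l}.ncard : ℚ) ∧
        (SymmTriad.nMult B θ₁ θ₂ a l : ℚ) =
            ({α ∈ SymmTriad.rootsNoncpt B θ₁ θ₂ t | B.proj a α = l}.ncard : ℚ) +
              1 / 2 * ({β ∈ SymmTriad.rootsCpx B θ₁ θ₂ t | B.proj a β = l}.ncard : ℚ) := by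
  subst ha
  have two_mul_m := fun l hl =>
    SymmTriad.two_mul_mMult (l := l) h₁ h₂ hcomm hform ht hstable hl
  have two_mul_n := fun l hl =>
    SymmTriad.two_mul_nMult (l := l) h₁ h₂ hcomm hform ht hstable hl
  have finite : (SymmTriad.roots B t \ SymmTriad.rootsZero B θ₁ θ₂ t).Finite :=
    (SymmTriad.finite_roots B t).sdiff
  rw [SymmTriad.sigmaSet_eq, SymmTriad.wSet_eq]
  refine ⟨SymmTriad.setOf_ne_zero_eq_image_union finite (fun _ => SymmTriad.proj_mem_roots)
      (Set.sep_subset _ _) (Set.sep_subset _ _) two_mul_m,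
    SymmTriad.setOf_ne_zero_eq_image_union finite (fun _ => SymmTriad.proj_mem_roots)
      (Set.sep_subset _ _) (Set.sep_subset _ _) two_mul_n, fun l hl => ⟨?_, ?_⟩⟩
  · have h : ((2 * _ : ℕ) : ℚ) = (_ : ℕ) := congrArg Nat.cast (two_mul_m l hl)
    push_cast at h
    linarith
  · have h : ((2 * _ : ℕ) : ℚ) = (_ : ℕ) := congrArg Nat.cast (two_mul_n l hl)
    push_cast at h
    linarith

theorem mainTheorem8
    {E : Type*} [NormedAddCommGroup E] [NormedSpace ℝ E] [FiniteDimensional ℝ E]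
    {G : Type*} [TopologicalSpace G] [ChartedSpace E G] [Group G] [LieGroup 𝓘(ℝ, E) ∞ G]
    [CompactSpace G] [ConnectedSpace G]
    (hsimple : LieAlgebra.IsSimple ℝ (GroupLieAlgebra 𝓘(ℝ, E) G))
    (Θ₁ Θ₂ : G ≃* G) (hΘ₁ : SymmTriad.IsInvolution E Θ₁) (hΘ₂ : SymmTriad.IsInvolution E Θ₂)
    (hcomm : ∀ g, Θ₁ (Θ₂ g) = Θ₂ (Θ₁ g))
    (B : SymmTriad.InvariantInnerProduct (GroupLieAlgebra 𝓘(ℝ, E) G))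
    (θ₁ θ₂ : Module.End ℝ (GroupLieAlgebra 𝓘(ℝ, E) G))
    (hθ₁ : θ₁ = SymmTriad.differential E Θ₁) (hθ₂ : θ₂ = SymmTriad.differential E Θ₂)
    (t a : Submodule ℝ (GroupLieAlgebra 𝓘(ℝ, E) G))
    (ht : SymmTriad.IsAdaptedTorus θ₁ θ₂ t) (ha : a = SymmTriad.aSpace θ₁ θ₂ t) :
    SymmTriad.sigmaSet B θ₁ θ₂ a =
        B.proj a '' SymmTriad.rootsCpt B θ₁ θ₂ t ∪ B.proj a '' SymmTriad.rootsCpx B θ₁ θ₂ t ∧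
      SymmTriad.wSet B θ₁ θ₂ a =
        B.proj a '' SymmTriad.rootsNoncpt B θ₁ θ₂ t ∪ B.proj a '' SymmTriad.rootsCpx B θ₁ θ₂ t ∧
      ∀ l ∈ SymmTriad.roots B a,
        (SymmTriad.mMult B θ₁ θ₂ a l : ℚ) =
            ({α ∈ SymmTriad.rootsCpt B θ₁ θ₂ t | B.proj a α = l}.ncard : ℚ) +
              1 / 2 * ({β ∈ SymmTriad.rootsCpx B θ₁ θ₂ t | B.proj a β = l}.ncard : ℚ) ∧
        (SymmTriad.nMult B θ₁ θ₂ a l : ℚ) =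
            ({α ∈ SymmTriad.rootsNoncpt B θ₁ θ₂ t | B.proj a α = l}.ncard : ℚ) +
              1 / 2 * ({β ∈ SymmTriad.rootsCpx B θ₁ θ₂ t | B.proj a β = l}.ncard : ℚ) := by
  subst hθ₁ hθ₂
  have := FiniteDimensional.complete ℝ E
  have h₁ := hΘ₁.isLieInvolution_differential
  have h₂ := hΘ₂.isLieInvolution_differential
  have hcomm' := SymmTriad.commute_differential hΘ₁.contMDiff hΘ₂.contMDiff hcomm
  exact mainTheorem8_general B h₁ h₂ hcomm' ((h₁.mul h₂ hcomm').form_map_map hsimple B) ht.maximal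
    (ht.mul_apply_mem h₁ h₂) ha
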